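/- Let $l,r,p$ be positive integers with $p>2$ and $l+r<p$. Let $C(l,r,p)$ be the S-Cantor set $$C(l,r,p)=\Big\{\sum_{i=1}^{\infty}\frac{x_i}{p^i}\colon x_i\in\{0,1,\dots,l-1\}\cup\{p-r,\dots,p-1\}\text{ for all } i\Big\},$$ and let $D=C(l,r,p)-C(l,r,p)=\{a-b\colon a,b\in C(l,r,p)\}$ be its difference set. Then: (1) $D=[-1,1]$ if and only if $2l+r\ge p$ or $l+2r\ge p$; (2) $D$ is a Cantor set if and only if $2l+2r\le p$; (3) $D$ is an M-Cantorval if and only if $2l+r<p$, $l+2r<p$ and $2l+2r>p$. Here a Cantor set is a nonempty bounded perfect nowhere dense subset of $\mathbb R$. A gap of a set $E\subset\mathbb R$ is a bounded connected component of $\mathbb R\setminus E$, and a proper component of $E$ is a connected component of $E$ that is not a singleton. A perfect set $E\subset\mathbb R$ is an M-Cantorval if it has infinitely many gaps and both endpoints of every gap are accumulated by gaps and proper components of $E$, i.e. every neighbourhood of such an endpoint contains a whole gap of $E$ and a whole proper component of $E$. -/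

import Mathlib

open scoped Pointwise

/-- `digitSet A p` is the set of all sums `∑_{i ≥ 1} x_i / p ^ i` with all digits `x_i` in `A`.
The digit `x_i` is `d (i - 1)`. -/
def digitSet (A : Set ℤ) (p : ℕ) : Set ℝ :=
  {x | ∃ d : ℕ → ℤ, (∀ i, d i ∈ A) ∧ HasSum (fun i : ℕ => (d i : ℝ) / (p : ℝ) ^ (i + 1)) x}

/-- The digits `0, …, l - 1` and `p - r, …, p - 1`. -/
def sDigits (l r p : ℕ) : Set ℤ :=
  Set.Icc 0 ((l : ℤ) - 1) ∪ Set.Icc ((p : ℤ) - r) ((p : ℤ) - 1)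

/-- The S-Cantor set `C(l, r, p)`. -/
def sCantor (l r p : ℕ) : Set ℝ := digitSet (sDigits l r p) p

/-- A Cantor set in the line: a nonempty, bounded, perfect, nowhere dense set. -/
structure IsCantorSet (E : Set ℝ) : Prop where
  nonempty : E.Nonempty
  bounded : Bornology.IsBounded E
  perfect : Perfect E
  nowhereDense : IsNowhereDense E

/-- `K` is a connected component of `S`. -/
def IsComponentOf (S K : Set ℝ) : Prop := ∃ x ∈ S, K = connectedComponentIn S x

/-- `G` is a gap of `E`: a bounded component of the complement of `E`. -/
def IsGap (E G : Set ℝ) : Prop := IsComponentOf Eᶜ G ∧ Bornology.IsBounded G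

/-- `K` is a proper component of `E`: a component that is not a singleton. -/
def IsProperComponent (E K : Set ℝ) : Prop := IsComponentOf E K ∧ ¬ ∃ x, K = {x}

/-- The point `x` is accumulated by gaps and by proper components of `E`: every neighbourhood of
`x` contains a whole gap of `E` and a whole proper component of `E`. If `E` is closed, none of these is a
singleton, so every neighbourhood then contains infinitely many of each. -/
def IsAccumulatedByGapsAndComponents (E : Set ℝ) (x : ℝ) : Prop :=
  ∀ ε > 0, (∃ G, IsGap E G ∧ G ⊆ Set.Ioo (x - ε) (x + ε)) ∧
    (∃ K, IsProperComponent E K ∧ K ⊆ Set.Ioo (x - ε) (x + ε))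

/-- An M-Cantorval: a perfect set with infinitely many gaps such that both endpoints of any gap
are accumulated by gaps and proper components. -/
structure IsMCantorval (E : Set ℝ) : Prop where
  perfect : Perfect E
  infinite_gaps : {G | IsGap E G}.Infinite
  left_endpoint : ∀ G u, IsGap E G → IsGLB G u → IsAccumulatedByGapsAndComponents E u
  right_endpoint : ∀ G v, IsGap E G → IsLUB G v → IsAccumulatedByGapsAndComponents E v

/-! Subtracting digit by digit, D is the digit set for the digits b with |b| < m or p - q < |b| < p,
where m = max l r and q = l + r. It is self-similar: D is the union of the copies (b + D)/p. If m +
q ≥ p, the intervals (b + [-1,1])/p cover [-1,1], so D = [-1,1]; otherwise (m/p, (p-q)/p) misses D.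
The interior depends on residues modulo p. If 2q > p, the digits represent every residue, the
integer translates of D cover the line, and Baire gives an interval (`interior_digitSet_nonempty`).
If 2q ≤ p, residue q is missing, and together with the gap of D this makes D nowhere dense
(`interior_digitSet_diffDigits_eq_empty`). In the remaining case, `exists_local_copy_of_gap` shows
that D just left of a gap looks like D just left of 1, which carries both a gap and an interval; the
symmetry D = -D handles right endpoints. -/

section DigitSets

/-! ### Digit sums in base p over a general digit set. -/

variable {A B : Set ℤ} {p : ℕ}

lemma hasSum_of_eq {f g : ℕ → ℝ} {c : ℝ} (h : ∀ i, f i = g i) (hg : HasSum g c) : HasSum f c := by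
  rwa [funext h]

/-- For c = ±1 these are the extreme expansions, which dominate all others. -/
lemma hasSum_const_digit (hp : 1 < p) (c : ℝ) :
    HasSum (fun i : ℕ => c * ((p : ℝ) - 1) / (p : ℝ) ^ (i + 1)) c := by
  have hp' : (1 : ℝ) < p := by exact_mod_cast hp
  have h := (hasSum_geometric_of_lt_one (r := (p : ℝ)⁻¹) (by positivity)
    (inv_lt_one_of_one_lt₀ hp')).mul_left (c * ((p : ℝ) - 1) / p)
  have h0 : (p : ℝ) - 1 ≠ 0 := by linarith
  have h1 : (1 : ℝ) - (p : ℝ)⁻¹ = (p - 1) / p := by field_simp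
  have h2 : c * ((p : ℝ) - 1) / p * (1 - (p : ℝ)⁻¹)⁻¹ = c := by
    rw [h1]
    field_simp
  rw [h2] at h
  refine hasSum_of_eq (fun i => ?_) h
  rw [inv_pow, pow_succ]
  field_simp

lemma summable_digits (hp : 1 < p) (hA : ∀ a ∈ A, |a| < p) {d : ℕ → ℤ} (hd : ∀ i, d i ∈ A) :
    Summable (fun i : ℕ => (d i : ℝ) / (p : ℝ) ^ (i + 1)) := by
  refine Summable.of_norm_bounded (hasSum_const_digit hp 1).summable fun i => ?_
  have h : |d i| ≤ (p : ℤ) - 1 := by have := hA _ (hd i); omega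
  have h' : |(d i : ℝ)| ≤ (p : ℝ) - 1 := by exact_mod_cast h
  rw [norm_div, Real.norm_eq_abs, norm_pow, Real.norm_natCast, one_mul]
  gcongr

lemma abs_le_one_of_mem_digitSet (hp : 1 < p) (hA : ∀ a ∈ A, |a| < p) {x : ℝ}
    (hx : x ∈ digitSet A p) : |x| ≤ 1 := by
  obtain ⟨d, hd, hs⟩ := hx
  have h (i) : |(d i : ℝ)| ≤ (p : ℝ) - 1 := by
    have h : |d i| ≤ (p : ℤ) - 1 := by have := hA _ (hd i); omega
    exact_mod_cast h
  rw [abs_le]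
  constructor
  · refine hasSum_le (fun i => ?_) (hasSum_const_digit hp (-1)) hs
    have := (abs_le.1 (h i)).1
    gcongr
    linarith
  · refine hasSum_le (fun i => ?_) hs (hasSum_const_digit hp 1)
    have := (abs_le.1 (h i)).2
    gcongr
    linarith

lemma zero_mem_digitSet (h : (0 : ℤ) ∈ A) : (0 : ℝ) ∈ digitSet A p :=
  ⟨fun _ => 0, fun _ => h, by simp⟩

lemma one_mem_digitSet (hp : 1 < p) (h : (p : ℤ) - 1 ∈ A) : (1 : ℝ) ∈ digitSet A p :=
  ⟨fun _ => p - 1, fun _ => h, by simpa using hasSum_const_digit hp 1⟩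

lemma neg_mem_digitSet (hA : ∀ a ∈ A, -a ∈ A) {x : ℝ} (hx : x ∈ digitSet A p) :
    -x ∈ digitSet A p := by
  obtain ⟨d, hd, hs⟩ := hx
  exact ⟨fun i => -d i, fun i => hA _ (hd i), by simpa [neg_div] using hs.neg⟩

lemma digitSet_sub_digitSet (hp : 1 < p) (hA : ∀ a ∈ A, |a| < p) (hB : ∀ a ∈ B, |a| < p) :
    digitSet A p - digitSet B p = digitSet (A - B) p := by
  ext x
  constructor
  · rintro ⟨y, ⟨d, hd, hy⟩, z, ⟨e, he, hz⟩, rfl⟩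
    exact ⟨fun i => d i - e i, fun i => Set.sub_mem_sub (hd i) (he i),
      by simpa [sub_div] using hy.sub hz⟩
  · rintro ⟨d, hd, hx⟩
    choose a ha b hb hab using fun i => Set.mem_sub.1 (hd i)
    have h1 := summable_digits hp hA ha
    have h2 := summable_digits hp hB hb
    refine ⟨_, ⟨a, ha, h1.hasSum⟩, _, ⟨b, hb, h2.hasSum⟩, ?_⟩
    refine (h1.hasSum.sub h2.hasSum).unique ?_
    refine hasSum_of_eq (fun i => ?_) hx
    rw [← hab i]
    push_cast
    ring

lemma mem_digitSet_iff (hp : 1 < p) {x : ℝ} :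
    x ∈ digitSet A p ↔ ∃ a ∈ A, ∃ t ∈ digitSet A p, x = (a + t) / p := by
  have hp0 : (p : ℝ) ≠ 0 := by positivity
  constructor
  · rintro ⟨d, hd, hx⟩
    have h := (hasSum_nat_add_iff' 1).2 hx
    refine ⟨d 0, hd 0, p * x - d 0, ⟨fun i => d (i + 1), fun i => hd _, ?_⟩, by field_simp; ring⟩
    have h' := h.mul_left (p : ℝ)
    have e : (p : ℝ) * (x - ∑ i ∈ Finset.range 1, (d i : ℝ) / (p : ℝ) ^ (i + 1)) = p * x - d 0 := by
      simp
      field_simp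
    rw [e] at h'
    refine hasSum_of_eq (fun i => ?_) h'
    rw [pow_succ (p : ℝ) (i + 1)]
    field_simp
  · rintro ⟨a, ha, t, ⟨d, hd, ht⟩, rfl⟩
    refine ⟨fun i => Nat.casesOn i a d, fun i => by cases i <;> simp [ha, hd], ?_⟩
    rw [← hasSum_nat_add_iff' 1]
    have e : (a + t) / (p : ℝ) - ∑ i ∈ Finset.range 1,
        ((Nat.casesOn i a d : ℤ) : ℝ) / (p : ℝ) ^ (i + 1) = t / p := by
      simp
      field_simp
      ring
    rw [e]
    refine hasSum_of_eq (fun i => ?_) (ht.div_const (p : ℝ))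
    rw [pow_succ (p : ℝ) (i + 1)]
    field_simp

/-- If the contractions `x ↦ (a + x) / p` cover `[-1, 1]`, then all its points are digit sums. -/
lemma Icc_subset_digitSet (hp : 1 < p) (hA : ∀ a ∈ A, |a| < p)
    (h : ∀ x ∈ Set.Icc (-1 : ℝ) 1, ∃ a ∈ A, ∃ t ∈ Set.Icc (-1 : ℝ) 1, x = (a + t) / p) :
    Set.Icc (-1 : ℝ) 1 ⊆ digitSet A p := by
  have hp0 : (p : ℝ) ≠ 0 := by positivity
  have hp1 : (1 : ℝ) < p := by exact_mod_cast hp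
  intro x hx
  choose a ha t ht hat using h
  -- The orbit of x under the chosen remainders; `d` records the digits read along it.
  let y : ℕ → Set.Icc (-1 : ℝ) 1 :=
    fun n => Nat.rec ⟨x, hx⟩ (fun _ z => ⟨t z.1 z.2, ht z.1 z.2⟩) n
  let d : ℕ → ℤ := fun n => a (y n).1 (y n).2
  have hd (i) : d i ∈ A := ha _ _
  have hy (n : ℕ) : (y n).1 = (d n + (y (n + 1)).1) / p := hat (y n).1 (y n).2
  have hpart (n : ℕ) :
      ∑ i ∈ Finset.range n, (d i : ℝ) / (p : ℝ) ^ (i + 1) = x - (y n).1 / (p : ℝ) ^ n := by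
    induction n with
    | zero => simp [y]
    | succ n ih =>
      rw [Finset.sum_range_succ, ih, hy n, pow_succ]
      field_simp
      ring
  have hlim : Filter.Tendsto (fun n => (y n).1 / (p : ℝ) ^ n) Filter.atTop (nhds 0) := by
    have h0 := tendsto_pow_atTop_nhds_zero_of_lt_one (r := (p : ℝ)⁻¹) (by positivity)
      (inv_lt_one_of_one_lt₀ hp1)
    refine squeeze_zero_norm (fun n => ?_) h0
    rw [norm_div, norm_pow, Real.norm_natCast, inv_pow, div_eq_mul_inv]
    exact mul_le_of_le_one_left (by positivity) (abs_le.2 (y n).2)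
  refine ⟨d, hd, ?_⟩
  have hs := (summable_digits hp hA hd).hasSum
  have h1 := hs.tendsto_sum_nat
  have h2 : Filter.Tendsto (fun n => x - (y n).1 / (p : ℝ) ^ n) Filter.atTop (nhds x) := by
    simpa using hlim.const_sub x
  simp only [hpart] at h1
  rwa [tendsto_nhds_unique h1 h2] at hs

/-- A continuous image of a product of finite sets. -/
lemma isCompact_digitSet (hp : 1 < p) (hA : ∀ a ∈ A, |a| < p) : IsCompact (digitSet A p) := by
  have hfin : A.Finite := (Set.finite_Icc (-(p : ℤ)) p).subset fun a ha =>
    ⟨(abs_lt.1 (hA a ha)).1.le, (abs_lt.1 (hA a ha)).2.le⟩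
  have hK : IsCompact (Set.pi Set.univ fun _ : ℕ => A) :=
    isCompact_univ_pi fun _ => hfin.isCompact
  have hc : ContinuousOn (fun d : ℕ → ℤ => ∑' i : ℕ, (d i : ℝ) / (p : ℝ) ^ (i + 1))
      (Set.pi Set.univ fun _ : ℕ => A) := by
    refine continuousOn_tsum (fun i => ?_) (hasSum_const_digit hp 1).summable fun i d hd => ?_
    · have : Continuous fun d : ℕ → ℤ => (d i : ℝ) :=
        continuous_of_discreteTopology.comp (continuous_apply i)
      exact (this.div_const _).continuousOn
    · have h : |d i| ≤ (p : ℤ) - 1 := by have := hA _ (hd i trivial); omega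
      have h' : |(d i : ℝ)| ≤ (p : ℝ) - 1 := by exact_mod_cast h
      rw [norm_div, Real.norm_eq_abs, norm_pow, Real.norm_natCast, one_mul]
      gcongr
  convert hK.image_of_continuousOn hc
  ext x
  constructor
  · rintro ⟨d, hd, hx⟩
    exact ⟨d, fun i _ => hd i, hx.tsum_eq⟩
  · rintro ⟨d, hd, rfl⟩
    exact ⟨d, fun i => hd i trivial,
      (summable_digits hp hA fun i => hd i trivial).hasSum⟩

/-- The integers written in base `p` with `n` digits from `A`. -/
def blocks (A : Set ℤ) (p : ℕ) : ℕ → Set ℤ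
  | 0 => {0}
  | n + 1 => {k | ∃ j ∈ blocks A p n, ∃ a ∈ A, k = p * j + a}

lemma mem_digitSet_iff_blocks (hp : 1 < p) (n : ℕ) {x : ℝ} :
    x ∈ digitSet A p ↔ ∃ k ∈ blocks A p n, ∃ t ∈ digitSet A p, x = (k + t) / (p : ℝ) ^ n := by
  have hp0 : (p : ℝ) ≠ 0 := by positivity
  induction n with
  | zero => simp [blocks]
  | succ n ih =>
    refine ih.trans ⟨?_, ?_⟩
    · rintro ⟨k, hk, t, ht, rfl⟩
      obtain ⟨a, ha, t', ht', rfl⟩ := (mem_digitSet_iff hp).1 ht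
      refine ⟨p * k + a, ⟨k, hk, a, ha, rfl⟩, t', ht', ?_⟩
      push_cast
      rw [pow_succ]
      field_simp
      ring
    · rintro ⟨_, ⟨k, hk, a, ha, rfl⟩, t, ht, rfl⟩
      refine ⟨k, hk, (a + t) / p, (mem_digitSet_iff hp).2 ⟨a, ha, t, ht, rfl⟩, ?_⟩
      push_cast
      rw [pow_succ]
      field_simp
      ring

/-- Match the last digit modulo p, then treat the quotient by induction. -/
lemma exists_blocks_modEq (hA : ∀ k : ℤ, ∃ a ∈ A, (p : ℤ) ∣ k - a) (n : ℕ) :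
    ∀ k : ℤ, ∃ j ∈ blocks A p n, (p : ℤ) ^ n ∣ k - j := by
  induction n with
  | zero => exact fun k => ⟨0, rfl, by simp⟩
  | succ n ih =>
    intro k
    obtain ⟨a, ha, c, hc⟩ := hA k
    obtain ⟨j, hj, e, he⟩ := ih c
    refine ⟨p * j + a, ⟨j, hj, a, ha, rfl⟩, e, ?_⟩
    rw [pow_succ]
    linear_combination hc + p * he

/-- The exponent is a successor so that a block of that length has a last digit to inspect. -/
lemma exists_pow_gt (hp : 1 < p) {ε : ℝ} (hε : 0 < ε) (c : ℝ) :
    ∃ n : ℕ, c < ε * (p : ℝ) ^ (n + 1) := by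
  have hp1 : (1 : ℝ) < p := by exact_mod_cast hp
  obtain ⟨n, hn⟩ := pow_unbounded_of_one_lt (c / ε) hp1
  refine ⟨n, ?_⟩
  rw [div_lt_iff₀ hε] at hn
  have : (p : ℝ) ^ n ≤ (p : ℝ) ^ (n + 1) := pow_le_pow_right₀ hp1.le (Nat.le_succ n)
  nlinarith

/-- If the digits cover all residues modulo `p`, then the integer translates of the digit set cover
the line, and Baire's theorem gives an interval. -/
lemma interior_digitSet_nonempty (hp : 1 < p) (hA : ∀ a ∈ A, |a| < p) (h0 : (0 : ℤ) ∈ A)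
    (hres : ∀ k : ℤ, ∃ a ∈ A, (p : ℤ) ∣ k - a) : (interior (digitSet A p)).Nonempty := by
  have hp0 : (0 : ℝ) < p := by positivity
  have hK := isCompact_digitSet hp hA
  have hZ : IsClosed (Set.range ((↑) : ℤ → ℝ)) := Int.isClosedEmbedding_coe_real.isClosed_range
  have hcl : IsClosed (Set.range ((↑) : ℤ → ℝ) + digitSet A p) :=
    hZ.add_right_of_isCompact hK
  have huniv : Set.range ((↑) : ℤ → ℝ) + digitSet A p = Set.univ := by
    rw [← hcl.closure_eq, Set.eq_univ_iff_forall]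
    intro x
    rw [Metric.mem_closure_iff]
    intro ε hε
    -- Density suffices because the sum is closed: the integer part of x p^(n+1) is a block modulo
    -- p^(n+1), which puts x within p^-(n+1) of a translate of D.
    obtain ⟨n, hn⟩ := exists_pow_gt hp hε 1
    have hP : (0 : ℝ) < (p : ℝ) ^ (n + 1) := by positivity
    obtain ⟨j, hj, e, he⟩ := exists_blocks_modEq hres (n + 1) ⌊x * (p : ℝ) ^ (n + 1)⌋
    refine ⟨(e : ℝ) + (j + 0) / (p : ℝ) ^ (n + 1), Set.add_mem_add ⟨e, rfl⟩
      ((mem_digitSet_iff_blocks hp (n + 1)).2 ⟨j, hj, 0, zero_mem_digitSet h0, rfl⟩), ?_⟩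
    have he' : (⌊x * (p : ℝ) ^ (n + 1)⌋ : ℝ) = j + (p : ℝ) ^ (n + 1) * e := by
      have : ⌊x * (p : ℝ) ^ (n + 1)⌋ = j + (p : ℤ) ^ (n + 1) * e := by linarith
      rw [this]
      push_cast
      ring
    have h1 := Int.floor_le (x * (p : ℝ) ^ (n + 1))
    have h2 := Int.lt_floor_add_one (x * (p : ℝ) ^ (n + 1))
    have h3 : x - ((e : ℝ) + (j + 0) / (p : ℝ) ^ (n + 1)) =
        (x * (p : ℝ) ^ (n + 1) - ⌊x * (p : ℝ) ^ (n + 1)⌋) / (p : ℝ) ^ (n + 1) := by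
      rw [he']
      field_simp
      ring
    rw [Real.dist_eq, h3, abs_of_nonneg (div_nonneg (by linarith) hP.le), div_lt_iff₀ hP]
    linarith
  have hU : ⋃ e : ℤ, (fun x : ℝ => (e : ℝ) + x) '' digitSet A p = Set.univ := by
    rw [Set.eq_univ_iff_forall]
    intro x
    obtain ⟨_, ⟨e, rfl⟩, y, hy, rfl⟩ := Set.mem_add.1 (huniv.symm ▸ Set.mem_univ x)
    exact Set.mem_iUnion.2 ⟨e, y, hy, rfl⟩
  obtain ⟨e, x, hx⟩ := nonempty_interior_of_iUnion_of_closed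
    (fun e : ℤ => (hK.image (continuous_const_add (e : ℝ))).isClosed) hU
  have h := (Homeomorph.addLeft (e : ℝ)).image_interior (digitSet A p)
  rw [Homeomorph.coe_addLeft] at h
  rw [← h] at hx
  obtain ⟨y, hy, -⟩ := hx
  exact ⟨y, hy⟩

lemma preperfect_digitSet (hp : 1 < p) (hA : ∀ a ∈ A, |a| < p) (hneg : ∀ a ∈ A, -a ∈ A)
    (h1 : (p : ℤ) - 1 ∈ A) : Preperfect (digitSet A p) := by
  intro x hx
  rw [accPt_iff_nhds]
  intro U hU
  obtain ⟨ε, hε, hU⟩ := Metric.mem_nhds_iff.1 hU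
  obtain ⟨n, hn⟩ := exists_pow_gt hp hε 2
  have hP : (0 : ℝ) < (p : ℝ) ^ (n + 1) := by positivity
  obtain ⟨k, hk, t, ht, rfl⟩ := (mem_digitSet_iff_blocks hp (n + 1)).1 hx
  have hone := one_mem_digitSet hp h1
  -- Replacing the tail t by another one moves the point by at most 2/p^(n+1).
  have key : ∃ z ∈ digitSet A p, z ≠ t := by
    by_cases h : t = 1
    · exact ⟨-1, neg_mem_digitSet hneg hone, by rw [h]; norm_num⟩
    · exact ⟨1, hone, Ne.symm h⟩
  obtain ⟨z, hz, hzt⟩ := key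
  refine ⟨(k + z) / (p : ℝ) ^ (n + 1), ⟨hU ?_, (mem_digitSet_iff_blocks hp (n + 1)).2
    ⟨k, hk, z, hz, rfl⟩⟩, fun h => hzt ?_⟩
  · have hz1 := abs_le.1 (abs_le_one_of_mem_digitSet hp hA hz)
    have ht1 := abs_le.1 (abs_le_one_of_mem_digitSet hp hA ht)
    rw [Metric.mem_ball, Real.dist_eq, ← sub_div, abs_div, abs_of_pos hP, div_lt_iff₀ hP]
    refine lt_of_le_of_lt ?_ hn
    rw [abs_le]
    constructor <;> linarith
  · rw [div_left_inj' hP.ne'] at h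
    linarith

lemma perfect_digitSet (hp : 1 < p) (hA : ∀ a ∈ A, |a| < p) (hneg : ∀ a ∈ A, -a ∈ A)
    (h1 : (p : ℤ) - 1 ∈ A) : Perfect (digitSet A p) :=
  ⟨(isCompact_digitSet hp hA).isClosed, preperfect_digitSet hp hA hneg h1⟩

/-- Next to the left endpoint of a gap, the digit set is a scaled copy of its part in `(0, 2)`. -/
lemma exists_local_copy_of_gap (hp : 1 < p) (hA : ∀ a ∈ A, |a| < p) (h0 : (0 : ℤ) ∈ A)
    (h1 : (p : ℤ) - 1 ∈ A) {u v : ℝ} (hu : u ∈ digitSet A p)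
    (hgap : ∀ x ∈ Set.Ioo u v, x ∉ digitSet A p) {n : ℕ} (hn : 2 < (v - u) * (p : ℝ) ^ n) :
    ∀ x ∈ Set.Ioo (0 : ℝ) 2, u + (x - 1) / (p : ℝ) ^ n ∈ digitSet A p ↔ x ∈ digitSet A p := by
  have hp1 : (1 : ℝ) < p := by exact_mod_cast hp
  have hP : (0 : ℝ) < (p : ℝ) ^ n := by positivity
  obtain ⟨k, hk, t, ht, rfl⟩ := (mem_digitSet_iff_blocks hp n).1 hu
  have hmem {j : ℤ} (hj : j ∈ blocks A p n) {z : ℝ} (hz : z ∈ digitSet A p)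
      (h : k + t < j + z) (h' : (j + z) - (k + t) ≤ 2) : False := by
    refine hgap _ ⟨div_lt_div_of_pos_right h hP, ?_⟩
      ((mem_digitSet_iff_blocks hp n).2 ⟨j, hj, z, hz, rfl⟩)
    have e : (v - (k + t) / (p : ℝ) ^ n) * (p : ℝ) ^ n = v * (p : ℝ) ^ n - (k + t) := by
      field_simp
    rw [div_lt_iff₀ hP]
    linarith
  have hone := one_mem_digitSet hp h1
  have ht1 := abs_le.1 (abs_le_one_of_mem_digitSet hp hA ht)
  -- If t < 1, the right end (k + 1)/p^n of the same copy would lie in the gap.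
  obtain rfl : t = 1 := by
    by_contra hne
    have := lt_of_le_of_ne ht1.2 hne
    exact hmem hk hone (by linarith) (by linarith)
  intro x hx
  have e : ((k : ℝ) + 1) / (p : ℝ) ^ n + (x - 1) / (p : ℝ) ^ n = (k + x) / (p : ℝ) ^ n := by
    rw [← add_div]
    ring
  rw [e]
  refine ⟨fun h => ?_, fun h => (mem_digitSet_iff_blocks hp n).2 ⟨k, hk, x, h, rfl⟩⟩
  obtain ⟨j, hj, z, hz, hjz⟩ := (mem_digitSet_iff_blocks hp n).1 h
  rw [div_left_inj' hP.ne'] at hjz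
  have hz1 := abs_le.1 (abs_le_one_of_mem_digitSet hp hA hz)
  have hlo : (k : ℝ) - 1 < j := by linarith [hx.1]
  have hhi : (j : ℝ) < k + 3 := by linarith [hx.2]
  have hlo' : k - 1 < j := by exact_mod_cast hlo
  have hhi' : j < k + 3 := by exact_mod_cast hhi
  -- Only the copy at k can meet the window: a copy at k + 1 would put its point (p-1)/p in the gap,
  -- and a copy at k + 2 its centre.
  obtain rfl | rfl | rfl : j = k ∨ j = k + 1 ∨ j = k + 2 := by omega
  · rwa [add_left_cancel hjz]
  · exfalso
    have hz' : (((p : ℤ) - 1 : ℤ) + 0 : ℝ) / p ∈ digitSet A p :=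
      (mem_digitSet_iff hp).2 ⟨_, h1, 0, zero_mem_digitSet h0, rfl⟩
    have ha : (0 : ℝ) < (((p : ℤ) - 1 : ℤ) + 0 : ℝ) / p := by
      push_cast
      exact div_pos (by linarith) (by linarith)
    have hb := (abs_le.1 (abs_le_one_of_mem_digitSet hp hA hz')).2
    refine hmem hj hz' ?_ ?_ <;> push_cast at * <;> linarith
  · exfalso
    refine hmem hj (zero_mem_digitSet h0) ?_ ?_ <;> push_cast <;> linarith

end DigitSets

section LineTopology

/-! ### Gaps and components of subsets of the line. -/

variable {E : Set ℝ}

/-- Gaps of a closed set are open intervals with endpoints in the set. -/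
lemma IsGap.exists_eq_Ioo (hE : IsClosed E) {G : Set ℝ} (hG : IsGap E G) :
    ∃ u ∈ E, ∃ v ∈ E, u < v ∧ G = Set.Ioo u v ∧ ∀ x ∈ Set.Ioo u v, x ∉ E := by
  obtain ⟨⟨x, hx, rfl⟩, hb⟩ := hG
  set G := connectedComponentIn Eᶜ x with hGdef
  have hopen : IsOpen G := hE.isOpen_compl.connectedComponentIn
  have hpre : IsPreconnected G := isPreconnected_connectedComponentIn
  have hxG : x ∈ G := mem_connectedComponentIn hx
  have hsub : G ⊆ Eᶜ := connectedComponentIn_subset _ _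
  have hbb := hb.bddBelow
  have hba := hb.bddAbove
  have hG : G = Set.Ioo (sInf G) (sSup G) := by
    refine Set.Subset.antisymm ?_ (IsConnected.Ioo_csInf_csSup_subset ⟨⟨x, hxG⟩, hpre⟩ hbb hba)
    rw [← interior_Icc]
    exact interior_maximal (subset_Icc_csInf_csSup hbb hba) hopen
  have hx' : x ∈ Set.Ioo (sInf G) (sSup G) := hG ▸ hxG
  have hlt := hx'.1.trans hx'.2
  -- A boundary point outside E could be adjoined to the component.
  have hclos (z : ℝ) (hz : z ∈ closure G) (hzG : z ∉ G) : z ∈ E := by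
    by_contra hzE
    refine hzG ?_
    have : IsPreconnected (insert z G) :=
      hpre.subset_closure (Set.subset_insert _ _) (Set.insert_subset hz subset_closure)
    exact this.subset_connectedComponentIn (Set.mem_insert_of_mem _ hxG)
      (Set.insert_subset hzE hsub) (Set.mem_insert _ _)
  have hends (z : ℝ) (hz : z ∈ G) : sInf G < z ∧ z < sSup G := hG.subset hz
  refine ⟨sInf G, hclos _ (csInf_mem_closure ⟨x, hxG⟩ hbb) ?_, sSup G,
    hclos _ (csSup_mem_closure ⟨x, hxG⟩ hba) ?_, hlt, hG, fun y hy => hsub (hG.symm ▸ hy)⟩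
  · exact fun h => lt_irrefl _ (hends _ h).1
  · exact fun h => lt_irrefl _ (hends _ h).2

lemma connectedComponentIn_subset_Ioo {S : Set ℝ} {a b x : ℝ} (ha : a ∉ S) (hb : b ∉ S)
    (hx : x ∈ S) (hax : a < x) (hxb : x < b) : connectedComponentIn S x ⊆ Set.Ioo a b := by
  have hord := (isPreconnected_connectedComponentIn (F := S) (x := x)).ordConnected
  have hxG := mem_connectedComponentIn hx
  have hsub := connectedComponentIn_subset S x
  intro y hy
  constructor
  · by_contra h
    exact ha (hsub (hord.out hy hxG ⟨not_lt.1 h, hax.le⟩))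
  · by_contra h
    exact hb (hsub (hord.out hxG hy ⟨hxb.le, not_lt.1 h⟩))

lemma exists_isGap_subset {a b y : ℝ} (ha : a ∈ E) (hb : b ∈ E) (hy : y ∉ E) (hay : a < y)
    (hyb : y < b) : ∃ G, IsGap E G ∧ G ⊆ Set.Ioo a b := by
  have h := connectedComponentIn_subset_Ioo (S := Eᶜ) (by simpa) (by simpa) hy hay hyb
  exact ⟨_, ⟨⟨y, hy, rfl⟩, (Metric.isBounded_Ioo a b).subset h⟩, h⟩

lemma exists_isProperComponent_subset {a b c d : ℝ} (ha : a ∉ E) (hb : b ∉ E)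
    (hcd : Set.Icc c d ⊆ E) (hac : a < c) (hlt : c < d) (hdb : d < b) :
    ∃ K, IsProperComponent E K ∧ K ⊆ Set.Ioo a b := by
  have hcE : c ∈ E := hcd ⟨le_rfl, hlt.le⟩
  refine ⟨_, ⟨⟨c, hcE, rfl⟩, ?_⟩,
    connectedComponentIn_subset_Ioo ha hb hcE hac (hlt.trans hdb)⟩
  rintro ⟨x, hx⟩
  have hI := isPreconnected_Icc.subset_connectedComponentIn (Set.left_mem_Icc.2 hlt.le) hcd
  rw [hx] at hI
  have h1 : c = x := hI (Set.left_mem_Icc.2 hlt.le)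
  have h2 : d = x := hI (Set.right_mem_Icc.2 hlt.le)
  linarith

lemma IsProperComponent.interior_nonempty {K : Set ℝ} (hK : IsProperComponent E K) :
    (interior E).Nonempty := by
  obtain ⟨⟨x, hx, rfl⟩, hK⟩ := hK
  have hxK := mem_connectedComponentIn hx
  have hord := (isPreconnected_connectedComponentIn (F := E) (x := x)).ordConnected
  have hsub := connectedComponentIn_subset E x
  obtain ⟨y, hy, hyx⟩ : ∃ y ∈ connectedComponentIn E x, y ≠ x := by
    by_contra! h
    exact hK ⟨x, Set.eq_singleton_iff_unique_mem.2 ⟨hxK, h⟩⟩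
  have key {a b : ℝ} (ha : a ∈ connectedComponentIn E x) (hb : b ∈ connectedComponentIn E x)
      (hab : a < b) : (interior E).Nonempty := by
    obtain ⟨z, hz⟩ := Set.nonempty_Ioo.2 hab
    exact ⟨z, interior_maximal
      ((Set.Ioo_subset_Icc_self.trans (hord.out ha hb)).trans hsub) isOpen_Ioo hz⟩
  rcases lt_or_gt_of_ne hyx with h | h
  · exact key hy hxK h
  · exact key hxK hy h

/-- Finitely many sample points, one per gap and all different from u, would leave a neighbourhood
of u containing no whole gap. -/
lemma infinite_gaps_of_accumulated {u : ℝ} (hu : u ∈ E)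
    (h : IsAccumulatedByGapsAndComponents E u) : {G | IsGap E G}.Infinite := by
  intro hfin
  have hne (G : Set ℝ) (hG : IsGap E G) : ∃ g ∈ G, g ∉ E := by
    obtain ⟨⟨x, hx, rfl⟩, -⟩ := hG
    exact ⟨x, mem_connectedComponentIn hx, hx⟩
  choose! g hgG hgE using hne
  have hF : (g '' {G | IsGap E G}).Finite := hfin.image g
  have hmem : (g '' {G | IsGap E G})ᶜ ∈ nhds u := by
    refine hF.isClosed.isOpen_compl.mem_nhds ?_
    rintro ⟨G, hG, rfl⟩
    exact hgE G hG hu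
  obtain ⟨ε, hε, hball⟩ := Metric.mem_nhds_iff.1 hmem
  obtain ⟨G, hG, hGsub⟩ := (h ε hε).1
  rw [Real.ball_eq_Ioo] at hball
  exact hball (hGsub (hgG G hG)) ⟨G, hG, rfl⟩

/-- Every neighbourhood of `u` meets `E` in the patterns that enclose a gap and a proper
component. -/
def HasPatternsNear (E : Set ℝ) (u : ℝ) : Prop :=
  ∀ ε > 0,
    (∃ a ∈ E, ∃ y ∉ E, ∃ b ∈ E, u - ε < a ∧ a < y ∧ y < b ∧ b < u + ε) ∧
    (∃ a ∉ E, ∃ b ∉ E, ∃ c d, Set.Icc c d ⊆ E ∧ u - ε < a ∧ a < c ∧ c < d ∧ d < b ∧ b < u + ε)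

lemma HasPatternsNear.isAccumulated {u : ℝ} (h : HasPatternsNear E u) :
    IsAccumulatedByGapsAndComponents E u := by
  intro ε hε
  obtain ⟨⟨a, ha, y, hy, b, hb, h1, h2, h3, h4⟩, a', ha', b', hb', c, d, hcd, k1, k2, k3, k4, k5⟩ :=
    h ε hε
  obtain ⟨G, hG, hGs⟩ := exists_isGap_subset ha hb hy h2 h3
  obtain ⟨K, hK, hKs⟩ := exists_isProperComponent_subset ha' hb' hcd k2 k3 k4
  exact ⟨⟨G, hG, hGs.trans (Set.Ioo_subset_Ioo h1.le h4.le)⟩,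
    K, hK, hKs.trans (Set.Ioo_subset_Ioo k1.le k5.le)⟩

lemma HasPatternsNear.neg (hE : ∀ x, -x ∈ E ↔ x ∈ E) {u : ℝ} (h : HasPatternsNear E u) :
    HasPatternsNear E (-u) := by
  intro ε hε
  obtain ⟨⟨a, ha, y, hy, b, hb, h1, h2, h3, h4⟩, a', ha', b', hb', c, d, hcd, k1, k2, k3, k4, k5⟩ :=
    h ε hε
  refine ⟨⟨-b, (hE b).2 hb, -y, fun h => hy ((hE y).1 h), -a, (hE a).2 ha, ?_, ?_, ?_, ?_⟩,
    -b', fun h => hb' ((hE b').1 h), -a', fun h => ha' ((hE a').1 h), -d, -c, ?_, ?_, ?_, ?_, ?_, ?_⟩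
  rotate_left 4
  · exact fun x hx => (hE x).1 (hcd ⟨by linarith [hx.2], by linarith [hx.1]⟩)
  all_goals linarith

end LineTopology

/-! ### The difference digits and the three regimes. -/

section Differences

/-- The differences of the digits: `|b| < m` or `p - q < |b| < p`. -/
def diffDigits (m q p : ℕ) : Set ℤ :=
  {b | |b| < m ∨ ((p : ℤ) - q < |b| ∧ |b| < p)}

lemma mem_diffDigits {m q p : ℕ} {b : ℤ} : b ∈ diffDigits m q p ↔
    (-(m : ℤ) < b ∧ b < m) ∨ (((p : ℤ) - q < b ∨ (p : ℤ) - q < -b) ∧ -(p : ℤ) < b ∧ b < p) := by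
  simp only [diffDigits, Set.mem_ofPred_eq, abs_lt, lt_abs]

lemma sDigits_sub_sDigits {l r p : ℕ} (hl : 1 ≤ l) (hr : 1 ≤ r) (hlr : l + r < p) :
    sDigits l r p - sDigits l r p = diffDigits (max l r) (l + r) p := by
  ext b
  simp only [Set.mem_sub, sDigits, mem_diffDigits, Set.mem_union, Set.mem_Icc]
  constructor
  · rintro ⟨x, hx, y, hy, rfl⟩
    push_cast
    omega
  · push_cast
    intro h
    by_cases hb : 0 ≤ b
    · by_cases h1 : b < l
      · exact ⟨b, by omega, 0, by omega, by omega⟩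
      by_cases h2 : b < r
      · exact ⟨p - 1, by omega, p - 1 - b, by omega, by omega⟩
      by_cases h3 : b ≤ (p : ℤ) - r
      · exact ⟨p - r, by omega, p - r - b, by omega, by omega⟩
      · exact ⟨b, by omega, 0, by omega, by omega⟩
    · by_cases h1 : -b < l
      · exact ⟨0, by omega, -b, by omega, by omega⟩
      by_cases h2 : -b < r
      · exact ⟨p - 1 + b, by omega, p - 1, by omega, by omega⟩
      by_cases h3 : -b ≤ (p : ℤ) - r
      · exact ⟨p - r + b, by omega, p - r, by omega, by omega⟩
      · exact ⟨0, by omega, -b, by omega, by omega⟩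

variable {m q p : ℕ}

lemma abs_lt_of_mem_diffDigits (hmq : m < q) (hqp : q < p) : ∀ b ∈ diffDigits m q p, |b| < p := by
  intro b hb
  rw [mem_diffDigits] at hb
  rw [abs_lt]
  omega

lemma neg_mem_diffDigits : ∀ b ∈ diffDigits m q p, -b ∈ diffDigits m q p := by
  intro b hb
  simpa [diffDigits] using hb

lemma zero_mem_diffDigits (hm : 1 ≤ m) : (0 : ℤ) ∈ diffDigits m q p := by
  simp only [mem_diffDigits]
  omega

lemma pred_mem_diffDigits (hm : 1 ≤ m) (hmq : m < q) (hqp : q < p) :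
    (p : ℤ) - 1 ∈ diffDigits m q p := by
  simp only [mem_diffDigits]
  omega

lemma digitSet_diffDigits_eq_Icc (hm : 1 ≤ m) (hmq : m < q) (hqp : q < p) (h : p ≤ m + q) :
    digitSet (diffDigits m q p) p = Set.Icc (-1 : ℝ) 1 := by
  have hp : 1 < p := by omega
  have hp1 : (1 : ℝ) < p := by exact_mod_cast hp
  have hA := abs_lt_of_mem_diffDigits hmq hqp
  refine Set.Subset.antisymm (fun x hx => abs_le.1 (abs_le_one_of_mem_digitSet hp hA hx))
    (Icc_subset_digitSet hp hA fun x hx => ?_)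
  have key : ∃ b ∈ diffDigits m q p, |p * x - b| ≤ 1 := by
    have h1 := Int.floor_le (p * x)
    have h2 := Int.lt_floor_add_one (p * x)
    have h3 : -(p : ℤ) ≤ ⌊p * x⌋ := by
      rw [Int.le_floor]
      push_cast
      nlinarith [hx.1]
    have h4 : ⌊p * x⌋ ≤ p := by
      have : (⌊p * x⌋ : ℝ) ≤ p := by nlinarith [hx.2]
      exact_mod_cast this
    by_cases hk : ⌊p * x⌋ ∈ diffDigits m q p
    · exact ⟨_, hk, abs_le.2 ⟨by linarith, by linarith⟩⟩
    by_cases hk' : ⌊p * x⌋ + 1 ∈ diffDigits m q p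
    · exact ⟨_, hk', abs_le.2 ⟨by push_cast; linarith, by push_cast; linarith⟩⟩
    -- The non-digits in [-p, p] are ±p and at most ±m, so two consecutive integers both fail only
    -- beyond p - 1, that is, for x = 1.
    have h5 : ⌊p * x⌋ = p := by
      simp only [mem_diffDigits] at hk hk'
      omega
    refine ⟨p - 1, pred_mem_diffDigits hm hmq hqp, ?_⟩
    have h6 : (p : ℝ) * x = p := by
      rw [h5] at h1
      push_cast at h1
      nlinarith [hx.2]
    rw [h6]
    push_cast
    simp
  obtain ⟨b, hb, hbx⟩ := key
  exact ⟨b, hb, p * x - b, abs_le.1 hbx, by field_simp; ring⟩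

/-- The digits up to m - 1 reach at most m, and those from p - q + 1 on reach down to p - q. -/
lemma notMem_digitSet_diffDigits (hmq : m < q) (hqp : q < p) {y : ℝ}
    (hy : (m : ℝ) < p * y) (hy' : p * y < p - q) : y ∉ digitSet (diffDigits m q p) p := by
  have hp : 1 < p := by omega
  intro h
  obtain ⟨b, hb, t, ht, rfl⟩ := (mem_digitSet_iff hp).1 h
  have ht1 := abs_le.1 (abs_le_one_of_mem_digitSet hp (abs_lt_of_mem_diffDigits hmq hqp) ht)
  have e : (p : ℝ) * ((b + t) / p) = b + t := by field_simp
  rw [e] at hy hy'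
  have h1 : (m : ℝ) < b + 1 := by linarith
  have h2 : (b : ℝ) < p - q + 1 := by linarith
  have h1' : (m : ℤ) < b + 1 := by exact_mod_cast h1
  have h2' : b < (p : ℤ) - q + 1 := by exact_mod_cast h2
  simp only [mem_diffDigits] at hb
  omega

lemma exists_notMem_digitSet_diffDigits (hqp : q < p) (h : m + q < p) (hmq : m < q) :
    ∃ y : ℝ, (m : ℝ) < p * y ∧ p * y < p - q ∧ y ∉ digitSet (diffDigits m q p) p := by
  have h' : (m : ℝ) + q < p := by exact_mod_cast h
  have hp : (p : ℝ) ≠ 0 := by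
    have : p ≠ 0 := by omega
    exact_mod_cast this
  have e : (p : ℝ) * ((m + p - q) / 2 / p) = (m + p - q) / 2 := by field_simp
  have h1 : (m : ℝ) < p * ((m + p - q) / 2 / p) := by rw [e]; linarith
  have h2 : (p : ℝ) * ((m + p - q) / 2 / p) < p - q := by rw [e]; linarith
  exact ⟨_, h1, h2, notMem_digitSet_diffDigits hmq hqp h1 h2⟩

lemma interior_digitSet_diffDigits (hm : 1 ≤ m) (hmq : m < q) (hqp : q < p) (h : p < 2 * q) :
    (interior (digitSet (diffDigits m q p) p)).Nonempty := by
  refine interior_digitSet_nonempty (by omega) (abs_lt_of_mem_diffDigits hmq hqp)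
    (zero_mem_diffDigits hm) fun k => ?_
  have h0 := Int.emod_nonneg k (b := p) (by omega)
  have h1 := Int.emod_lt_of_pos k (b := p) (by omega)
  have h2 := Int.emod_add_mul_ediv k p
  -- A nonzero residue above p - q is itself a digit; one below q is a digit after subtracting p.
  -- Since 2q > p, one of the two applies.
  have key : k % p ∈ diffDigits m q p ∨ k % p - p ∈ diffDigits m q p := by
    simp only [mem_diffDigits]
    omega
  rcases key with hb | hb
  · exact ⟨_, hb, k / p, by linarith⟩
  · exact ⟨_, hb, k / p + 1, by linarith⟩

lemma interior_digitSet_diffDigits_eq_empty (hmq : m < q) (hqp : q < p) (h : 2 * q ≤ p) :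
    interior (digitSet (diffDigits m q p) p) = ∅ := by
  have hp : 1 < p := by omega
  have hp1 : (1 : ℝ) < p := by exact_mod_cast hp
  have hA := abs_lt_of_mem_diffDigits hmq hqp
  obtain ⟨y, hy, hy', hyD⟩ := exists_notMem_digitSet_diffDigits hqp (by omega : m + q < p) hmq
  have hy0 : 0 < y := by
    by_contra hneg
    have : (0 : ℝ) ≤ m := by positivity
    nlinarith
  have hy1 : y < 1 := by
    by_contra hge
    have : (0 : ℝ) ≤ q := by positivity
    nlinarith
  rw [Set.eq_empty_iff_forall_notMem]
  intro x hx
  obtain ⟨ε, hε, hball⟩ := Metric.mem_nhds_iff.1 (mem_interior_iff_mem_nhds.1 hx)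
  obtain ⟨n, hn⟩ := exists_pow_gt hp hε p
  have hP : (0 : ℝ) < (p : ℝ) ^ (n + 1) := by positivity
  set X := x * (p : ℝ) ^ (n + 1) with hX
  -- At scale p^(n+1), the points kp + q - 1 + y all avoid D; this k selects one within p of X.
  set k := ⌊(X - (q - 1 + y)) / p⌋ with hk
  have h1 : (k : ℝ) * p ≤ X - (q - 1 + y) := by
    rw [← le_div_iff₀ (by linarith)]
    exact Int.floor_le _
  have h2 : X - (q - 1 + y) < (k + 1) * p := by
    rw [← div_lt_iff₀ (by linarith)]
    exact Int.lt_floor_add_one _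
  have hz : (k * p + (q - 1 + y)) / (p : ℝ) ^ (n + 1) ∈ digitSet (diffDigits m q p) p := by
    refine hball ?_
    have e : (k * p + (q - 1 + y)) / (p : ℝ) ^ (n + 1) - x =
        -((X - (q - 1 + y)) - k * p) / (p : ℝ) ^ (n + 1) := by
      rw [hX]
      field_simp
      ring
    rw [Metric.mem_ball, Real.dist_eq, e, abs_div, abs_neg, abs_of_pos hP, div_lt_iff₀ hP,
      abs_of_nonneg (by linarith)]
    linarith
  obtain ⟨j, hj, t, ht, hjt⟩ := (mem_digitSet_iff_blocks hp (n + 1)).1 hz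
  rw [div_left_inj' hP.ne'] at hjt
  have ht1 := abs_le.1 (abs_le_one_of_mem_digitSet hp hA ht)
  obtain ⟨i, -, b, hb, rfl⟩ := hj
  have h3 : ((k * p + q - 1 - 1 : ℤ) : ℝ) < ((p * i + b : ℤ) : ℝ) := by push_cast at *; linarith
  have h4 : ((p * i + b : ℤ) : ℝ) < ((k * p + q - 1 + 2 : ℤ) : ℝ) := by push_cast at *; linarith
  rw [Int.cast_lt] at h3 h4
  -- The first block forces the tail to be y, which is not in D; the second needs a digit congruent
  -- to q, and none exists when 2q ≤ p.
  obtain h5 | h5 : (p : ℤ) * i + b = k * p + q - 1 ∨ (p : ℤ) * i + b = k * p + q := by omega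
  · refine hyD ?_
    have : y = t := by
      rw [h5] at hjt
      push_cast at hjt
      linarith
    rwa [this]
  · have hb' : b = q + p * (k - i) := by linarith
    generalize k - i = c at hb'
    simp only [mem_diffDigits] at hb
    have hc1 : c < 1 := by
      by_contra hc
      have : (p : ℤ) * 1 ≤ p * c := by gcongr; omega
      omega
    have hc2 : -2 < c := by
      by_contra hc
      have : (p : ℤ) * c ≤ p * (-2) := by gcongr; omega
      omega
    obtain rfl | rfl : c = 0 ∨ c = -1 := by omega
    · omega
    · omega

lemma isMCantorval_digitSet_diffDigits (hm : 1 ≤ m) (hmq : m < q) (hqp : q < p)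
    (h : m + q < p) (h' : p < 2 * q) : IsMCantorval (digitSet (diffDigits m q p) p) := by
  have hp : 1 < p := by omega
  have hp1 : (1 : ℝ) < p := by exact_mod_cast hp
  have hp0 : (0 : ℝ) < p := by linarith
  have hA := abs_lt_of_mem_diffDigits hmq hqp
  have hpred := pred_mem_diffDigits hm hmq hqp
  have hzero := zero_mem_diffDigits (q := q) (p := p) hm
  have hneg := neg_mem_diffDigits (m := m) (q := q) (p := p)
  have hint := interior_digitSet_diffDigits hm hmq hqp h'
  have hperf := perfect_digitSet hp hA hneg hpred
  obtain ⟨y, hy, hy', hyD⟩ := exists_notMem_digitSet_diffDigits hqp h hmq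
  have ha : (m : ℝ) / p ∈ digitSet (diffDigits m q p) p := by
    refine (mem_digitSet_iff hp).2 ⟨m - 1, ?_, 1, one_mem_digitSet hp hpred, by push_cast; ring⟩
    simp only [mem_diffDigits]
    omega
  have hb : ((p : ℝ) - q) / p ∈ digitSet (diffDigits m q p) p := by
    refine (mem_digitSet_iff hp).2 ⟨p - q + 1, ?_, -1,
      neg_mem_digitSet hneg (one_mem_digitSet hp hpred), by push_cast; ring⟩
    simp only [mem_diffDigits]
    omega
  have hm' : (1 : ℝ) ≤ m := by exact_mod_cast hm
  have hq' : (2 : ℝ) ≤ q := by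
    have : 2 ≤ q := by omega
    exact_mod_cast this
  have ha0 : (0 : ℝ) < m / p := by positivity
  have hay : (m : ℝ) / p < y := by rw [div_lt_iff₀ hp0]; linarith
  have hyb : y < ((p : ℝ) - q) / p := by rw [lt_div_iff₀ hp0]; linarith
  have hb1 : ((p : ℝ) - q) / p < 1 := by rw [div_lt_one hp0]; linarith
  -- Shrinking an interval of D into the copy with first digit p - 1 places it between y and 1.
  obtain ⟨c, d, hcd, hcdD, hyc, hd1⟩ : ∃ c d : ℝ, c < d ∧
      Set.Icc c d ⊆ digitSet (diffDigits m q p) p ∧ y < c ∧ d ≤ 1 := by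
    obtain ⟨x, hx⟩ := hint
    obtain ⟨ε, hε, hball⟩ := Metric.nhds_basis_closedBall.mem_iff.1 (mem_interior_iff_mem_nhds.1 hx)
    rw [Real.closedBall_eq_Icc] at hball
    have hsub : Set.Icc ((p - 1 + (x - ε)) / p) ((p - 1 + (x + ε)) / p) ⊆
        digitSet (diffDigits m q p) p := by
      intro z hz
      rw [Set.mem_Icc, div_le_iff₀ hp0, le_div_iff₀ hp0] at hz
      exact (mem_digitSet_iff hp).2 ⟨p - 1, hpred, z * p - (p - 1),
        hball ⟨by linarith, by linarith⟩, by push_cast; field_simp; ring⟩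
    have hlt : ((p : ℝ) - 1 + (x - ε)) / p < (p - 1 + (x + ε)) / p := by
      gcongr
      linarith
    refine ⟨_, _, hlt, hsub, ?_, ?_⟩
    · have := abs_le.1 (abs_le_one_of_mem_digitSet hp hA
        (hball ⟨le_rfl, by linarith⟩ : x - ε ∈ digitSet (diffDigits m q p) p))
      rw [lt_div_iff₀ hp0]
      linarith [this.1]
    · exact (abs_le.1 (abs_le_one_of_mem_digitSet hp hA (hsub (Set.right_mem_Icc.2 hlt.le)))).2
  have hout : (3 / 2 : ℝ) ∉ digitSet (diffDigits m q p) p := fun hmem => by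
    have := (abs_le.1 (abs_le_one_of_mem_digitSet hp hA hmem)).2
    norm_num at this
  -- The local copy carries to u the gap pattern m/p < y < (p-q)/p and the component pattern y < c <
  -- d < 3/2, all inside (0, 2).
  have key {u v : ℝ} (hu : u ∈ digitSet (diffDigits m q p) p) (huv : u < v)
      (hgap : ∀ x ∈ Set.Ioo u v, x ∉ digitSet (diffDigits m q p) p) :
      HasPatternsNear (digitSet (diffDigits m q p) p) u := by
    intro ε hε
    obtain ⟨n, hn⟩ := exists_pow_gt hp (lt_min hε (sub_pos.2 huv)) 2
    generalize n + 1 = N at hn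
    have hP : (0 : ℝ) < (p : ℝ) ^ N := by positivity
    have hn1 : 2 < ε * (p : ℝ) ^ N := hn.trans_le (by gcongr; exact min_le_left _ _)
    have hn2 : 2 < (v - u) * (p : ℝ) ^ N := hn.trans_le (by gcongr; exact min_le_right _ _)
    have hloc := exists_local_copy_of_gap hp hA hzero hpred hu hgap hn2
    have hmono {s t : ℝ} (hst : s < t) : u + (s - 1) / (p : ℝ) ^ N < u + (t - 1) / (p : ℝ) ^ N := by
      gcongr
    have hlo {s : ℝ} (hs : 0 < s) : u - ε < u + (s - 1) / (p : ℝ) ^ N := by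
      have : -ε < (s - 1) / (p : ℝ) ^ N := by rw [lt_div_iff₀ hP]; linarith
      linarith
    have hhi {s : ℝ} (hs : s < 2) : u + (s - 1) / (p : ℝ) ^ N < u + ε := by
      have : (s - 1) / (p : ℝ) ^ N < ε := by rw [div_lt_iff₀ hP]; linarith
      linarith
    refine ⟨⟨_, (hloc _ ⟨ha0, by linarith⟩).2 ha, _,
      fun hmem => hyD ((hloc _ ⟨by linarith, by linarith⟩).1 hmem), _,
      (hloc _ ⟨by linarith, by linarith⟩).2 hb, hlo ha0, hmono hay, hmono hyb,
      hhi (by linarith)⟩, _,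
      fun hmem => hyD ((hloc _ ⟨by linarith, by linarith⟩).1 hmem), _,
      fun hmem => hout ((hloc _ ⟨by norm_num, by norm_num⟩).1 hmem),
      u + (c - 1) / (p : ℝ) ^ N, u + (d - 1) / (p : ℝ) ^ N, fun z hz => ?_, hlo (by linarith),
      hmono hyc, hmono hcd, hmono (by linarith), hhi (by norm_num)⟩
    have hz1 : (c - 1) ≤ (z - u) * (p : ℝ) ^ N := by
      rw [← div_le_iff₀ hP]
      linarith [hz.1]
    have hz2 : (z - u) * (p : ℝ) ^ N ≤ d - 1 := by
      rw [← le_div_iff₀ hP]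
      linarith [hz.2]
    have e : z = u + ((1 + (z - u) * (p : ℝ) ^ N) - 1) / (p : ℝ) ^ N := by
      field_simp
      ring
    rw [e]
    exact (hloc _ ⟨by linarith, by linarith⟩).2 (hcdD ⟨by linarith, by linarith⟩)
  have hsymm (x : ℝ) : -x ∈ digitSet (diffDigits m q p) p ↔ x ∈ digitSet (diffDigits m q p) p :=
    ⟨fun hx => by simpa using neg_mem_digitSet hneg hx, fun hx => neg_mem_digitSet hneg hx⟩
  have hleft (G : Set ℝ) (u : ℝ) (hG : IsGap (digitSet (diffDigits m q p) p) G)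
      (hu : IsGLB G u) : IsAccumulatedByGapsAndComponents (digitSet (diffDigits m q p) p) u := by
    obtain ⟨u', hu', v', hv', huv, rfl, hgap⟩ := hG.exists_eq_Ioo hperf.closed
    rw [hu.unique (isGLB_Ioo huv)]
    exact (key hu' huv hgap).isAccumulated
  obtain ⟨G, hG, -⟩ := exists_isGap_subset ha hb hyD hay hyb
  refine ⟨hperf, ?_, hleft, fun G v hG hv => ?_⟩
  · obtain ⟨u', hu', v', hv', huv, rfl, hgap⟩ := hG.exists_eq_Ioo hperf.closed
    exact infinite_gaps_of_accumulated hu' (hleft _ _ hG (isGLB_Ioo huv))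
  · obtain ⟨u', hu', v', hv', huv, rfl, hgap⟩ := hG.exists_eq_Ioo hperf.closed
    rw [hv.unique (isLUB_Ioo huv)]
    -- Reflection turns the right endpoint into a left one.
    have hk := key (u := -v') (v := -u') ((hsymm _).2 hv') (by linarith) fun x hx hxD =>
      hgap (-x) ⟨by linarith [hx.2], by linarith [hx.1]⟩ ((hsymm _).2 hxD)
    simpa using (hk.neg hsymm).isAccumulated

lemma not_isMCantorval_Icc : ¬ IsMCantorval (Set.Icc (-1 : ℝ) 1) := by
  intro h
  obtain ⟨G, hG⟩ := h.infinite_gaps.nonempty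
  obtain ⟨u, hu, v, hv, huv, -, hgap⟩ := hG.exists_eq_Ioo isClosed_Icc
  obtain ⟨x, hx⟩ := Set.nonempty_Ioo.2 huv
  exact hgap x hx ⟨hu.1.trans hx.1.le, hx.2.le.trans hv.2⟩

lemma IsMCantorval.interior_nonempty {E : Set ℝ} (h : IsMCantorval E) :
    (interior E).Nonempty := by
  obtain ⟨G, hG⟩ := h.infinite_gaps.nonempty
  obtain ⟨u, -, v, -, huv, rfl, -⟩ := hG.exists_eq_Ioo h.perfect.closed
  obtain ⟨K, hK, -⟩ := (h.left_endpoint _ u hG (isGLB_Ioo huv) 1 one_pos).2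
  exact hK.interior_nonempty

end Differences

theorem corollary7 (l r p : ℕ) (hl : 1 ≤ l) (hr : 1 ≤ r) (hp : 2 < p) (hlr : l + r < p) :
    (sCantor l r p - sCantor l r p = Set.Icc (-1 : ℝ) 1 ↔ 2 * l + r ≥ p ∨ l + 2 * r ≥ p) ∧
    (IsCantorSet (sCantor l r p - sCantor l r p) ↔ 2 * l + 2 * r ≤ p) ∧
    (IsMCantorval (sCantor l r p - sCantor l r p) ↔
      2 * l + r < p ∧ l + 2 * r < p ∧ 2 * l + 2 * r > p) := by
  have hD : sCantor l r p - sCantor l r p = digitSet (diffDigits (max l r) (l + r) p) p := by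
    have hdig : ∀ a ∈ sDigits l r p, |a| < p := by
      intro a ha
      simp only [sDigits, Set.mem_union, Set.mem_Icc] at ha
      rw [abs_lt]
      omega
    rw [sCantor, digitSet_sub_digitSet (by omega) hdig hdig, sDigits_sub_sDigits hl hr hlr]
  rw [hD]
  have hm : 1 ≤ max l r := by omega
  have hmq : max l r < l + r := by omega
  have hp' : 1 < p := by omega
  have hA := abs_lt_of_mem_diffDigits hmq hlr
  have hcomp := isCompact_digitSet hp' hA
  refine ⟨⟨fun h => ?_, fun h => digitSet_diffDigits_eq_Icc hm hmq hlr (by omega)⟩,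
    ⟨fun h => ?_, fun h => ?_⟩, ⟨fun h => ?_, fun h =>
      isMCantorval_digitSet_diffDigits hm hmq hlr (by omega) (by omega)⟩⟩
  · by_contra hn
    obtain ⟨y, hy, hy', hyD⟩ :=
      exists_notMem_digitSet_diffDigits hlr (by omega : max l r + (l + r) < p) hmq
    rw [h] at hyD
    have hp0 : (0 : ℝ) < p := by positivity
    have h0 : (0 : ℝ) ≤ (max l r : ℕ) := by positivity
    have h1 : (0 : ℝ) ≤ (l + r : ℕ) := by positivity
    exact hyD ⟨by nlinarith, by nlinarith⟩
  · by_contra hn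
    have hint := interior_digitSet_diffDigits hm hmq hlr (by omega)
    have hnd := h.nowhereDense
    rw [IsNowhereDense, hcomp.isClosed.closure_eq] at hnd
    exact hint.ne_empty hnd
  · refine ⟨⟨0, zero_mem_digitSet (zero_mem_diffDigits hm)⟩, hcomp.isBounded,
      perfect_digitSet hp' hA neg_mem_diffDigits (pred_mem_diffDigits hm hmq hlr), ?_⟩
    rw [IsNowhereDense, hcomp.isClosed.closure_eq]
    exact interior_digitSet_diffDigits_eq_empty hmq hlr (by omega)
  · have h1 : ¬ p ≤ max l r + (l + r) := fun hle => by
      rw [digitSet_diffDigits_eq_Icc hm hmq hlr hle] at h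
      exact not_isMCantorval_Icc h
    have h2 : ¬ 2 * (l + r) ≤ p := fun hle =>
      h.interior_nonempty.ne_empty (interior_digitSet_diffDigits_eq_empty hmq hlr hle)
    omega
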